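/- Identify the operators on $(\mathbb{C}^2)^{\otimes m}$ with $2^m\times 2^m$ complex matrices through the product of the standard bases, and call a matrix $\rho$ on $(\mathbb{C}^2)^{\otimes m}$ separable if it is a finite sum of matrices $A_1\otimes\cdots\otimes A_m$ with every $A_i$ a positive semidefinite Hermitian $2\times 2$ matrix. Let $\|A\|_2=\sqrt{\operatorname{tr}A^\dagger A}$ be the Frobenius norm. Let $m$ be a natural number and let $\rho$ be an $m$-qubit unnormalized density matrix, that is, a positive semidefinite Hermitian matrix on $(\mathbb{C}^2)^{\otimes m}$ (of any trace). If $$\|\rho-I\|_2\le\left(\tfrac23\right)^{m/2-1},$$ then $\rho$ is separable. For $m>2$ this radius is strictly larger than the earlier bound: $(1/2)^{m/2-1}<(2/3)^{m/2-1}$. -/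

import Mathlib

open scoped Matrix.Norms.Frobenius ComplexOrder

namespace MultipartiteSeparability

/-- The tensor (Kronecker) product `A₁ ⊗ ⋯ ⊗ A_m` of a finite family of square matrices, as a
matrix in the product basis: its entry at the multi-indices `x`, `y` is `∏ i, (A i) (x i) (y i)`. -/
def tensorProd {ι : Type*} [Fintype ι] {n : ι → Type*} (A : ∀ i, Matrix (n i) (n i) ℂ) :
    Matrix (∀ i, n i) (∀ i, n i) ℂ :=
  Matrix.of fun x y => ∏ i, A i (x i) (y i)

/-- The separable cone `𝒮(C₁, …, C_m)`: the convex cone generated by the tensor products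
`A₁ ⊗ ⋯ ⊗ A_m` with `A i ∈ C i`, i.e. all finite combinations of such products with
nonnegative real coefficients. -/
noncomputable def separableCone {ι : Type*} [Fintype ι] {n : ι → Type*}
    (C : ∀ i, Set (Matrix (n i) (n i) ℂ)) :
    PointedCone ℝ (Matrix (∀ i, n i) (∀ i, n i) ℂ) :=
  PointedCone.hull ℝ {X | ∃ A : ∀ i, Matrix (n i) (n i) ℂ, (∀ i, A i ∈ C i) ∧ X = tensorProd A}

/-- The cone `𝒫(n)` of positive semidefinite Hermitian matrices. -/
def psdCone (n : Type*) [Fintype n] : Set (Matrix n n ℂ) :=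
  {A | A.PosSemidef}

/-- Separability of an unnormalized multipartite density matrix: membership in the separable cone
of the local positive semidefinite cones. -/
def IsSeparable {ι : Type*} [Fintype ι] {n : ι → Type*} [∀ i, Fintype (n i)]
    (ρ : Matrix (∀ i, n i) (∀ i, n i) ℂ) : Prop :=
  ρ ∈ separableCone fun i => psdCone (n i)

/-- Matrices on the space of `m` qubits `ℂ² ⊗ ⋯ ⊗ ℂ²`, in the product basis indexed by
`Fin m → Fin 2`. -/
abbrev QubitMatrix (m : ℕ) : Type :=
  Matrix (Fin m → Fin 2) (Fin m → Fin 2) ℂ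

end MultipartiteSeparability

namespace MultipartiteSeparability

open Matrix

/-! By duality, a non-separable `ρ ≥ 0` has a block-positive witness `W` with `Re tr (W ρ) < 0`
(`exists_isBlockPositive_trace_mul_neg`). Since `tr (W ρ) = tr W + tr (W (ρ - 1))`, Cauchy–Schwarz
excludes this once `‖W‖ ‖ρ - 1‖ ≤ tr W`, so all rests on bounding `‖W‖` by `tr W`
(`IsBlockPositive.norm_sq_le`).

That bound is an induction on qubits. Compressing the first qubit by a vector leaves a
block-positive matrix, to which the bound `‖·‖² ≤ C tr²` applies. Averaging over four relative
phases isolates the off-diagonal blocks, and `‖H‖² ≥ |tr H|² / N` sharpens their estimate (`N` the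
size of a block). The constant passes from `C` to `max C (3/2 C - 1/N)`: it stays 1 up to two
qubits, and then grows by at most `3/2` per qubit. -/

lemma frobenius_norm_sq {n m : Type*} [Fintype n] [Fintype m] (A : Matrix n m ℂ) :
    ‖A‖ ^ 2 = ∑ x, ∑ y, ‖A x y‖ ^ 2 := by
  have h : 0 ≤ ∑ x, ∑ y, ‖A x y‖ ^ 2 := by positivity
  rw [frobenius_norm_def, ← Real.rpow_natCast, ← Real.rpow_mul]
  · simp
  · simpa using h

lemma trace_conjTranspose_mul_self_eq {n : Type*} [Fintype n] (A : Matrix n n ℂ) :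
    trace (Aᴴ * A) = ((‖A‖ ^ 2 : ℝ) : ℂ) := by
  rw [frobenius_norm_sq, Finset.sum_comm]
  simp only [trace, diag_apply, mul_apply, conjTranspose_apply, Complex.ofReal_sum]
  refine Finset.sum_congr rfl fun x _ => Finset.sum_congr rfl fun y _ => ?_
  rw [Complex.star_def, Complex.conj_mul']
  push_cast
  rfl

lemma frobenius_norm_unitary_conj {n : Type*} [Fintype n] [DecidableEq n] (U M : Matrix n n ℂ)
    (hU : U * Uᴴ = 1) : ‖Uᴴ * M * U‖ ^ 2 = ‖M‖ ^ 2 := by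
  have h : trace ((Uᴴ * M * U)ᴴ * (Uᴴ * M * U)) = trace (Mᴴ * M) := by
    calc trace ((Uᴴ * M * U)ᴴ * (Uᴴ * M * U)) = trace (Uᴴ * (Mᴴ * (U * Uᴴ) * M * U)) := by
          simp only [conjTranspose_mul, conjTranspose_conjTranspose, Matrix.mul_assoc]
      _ = trace (Mᴴ * M) := by
          rw [trace_mul_comm, hU, Matrix.mul_one, Matrix.mul_assoc, hU, Matrix.mul_one]
  rw [trace_conjTranspose_mul_self_eq, trace_conjTranspose_mul_self_eq] at h
  exact_mod_cast h

lemma norm_trace_sq_le {n : Type*} [Fintype n] (A : Matrix n n ℂ) :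
    ‖trace A‖ ^ 2 ≤ Fintype.card n * ‖A‖ ^ 2 := by
  calc ‖trace A‖ ^ 2 ≤ (∑ x, ‖A x x‖) ^ 2 := by
        gcongr
        exact norm_sum_le _ _
    _ ≤ Fintype.card n * ∑ x, ‖A x x‖ ^ 2 := by
        simpa using sq_sum_le_card_mul_sum_sq (s := Finset.univ) (f := fun x => ‖A x x‖)
    _ ≤ Fintype.card n * ‖A‖ ^ 2 := by
        rw [frobenius_norm_sq]
        gcongr with x
        exact Finset.single_le_sum (f := fun y => ‖A x y‖ ^ 2) (fun _ _ => by positivity)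
          (Finset.mem_univ x)

/-! ### Norm bounds for `2 × 2` block matrices from their compressions -/

/-- The compression of a `2 × 2` block matrix `V` by a vector `v` of the outer factor. -/
noncomputable def blockSlice {n : Type*} (V : Fin 2 → Fin 2 → Matrix n n ℂ) (v : Fin 2 → ℂ) :
    Matrix n n ℂ :=
  ∑ i, ∑ j, (star (v i) * v j) • V i j

/-- The four terms are `h + z a + z̄ b` for `z = ±1, ±i`. Cross terms carry `z`, `z²` or their
conjugates, all of which sum to zero over the fourth roots of unity. -/
lemma norm_sq_add_phases (h a b : ℂ) :
    ‖h + a + b‖ ^ 2 + ‖h - a - b‖ ^ 2 + ‖h + Complex.I * a - Complex.I * b‖ ^ 2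
      + ‖h - Complex.I * a + Complex.I * b‖ ^ 2 = 4 * (‖h‖ ^ 2 + ‖a‖ ^ 2 + ‖b‖ ^ 2) := by
  simp only [← Complex.normSq_eq_norm_sq, Complex.normSq_apply, Complex.add_re, Complex.add_im,
    Complex.sub_re, Complex.sub_im, Complex.mul_re, Complex.mul_im, Complex.I_re, Complex.I_im]
  ring

lemma frobenius_norm_sq_add_phases {n : Type*} [Fintype n] (H A B : Matrix n n ℂ) :
    ‖H + A + B‖ ^ 2 + ‖H - A - B‖ ^ 2 + ‖H + Complex.I • A - Complex.I • B‖ ^ 2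
      + ‖H - Complex.I • A + Complex.I • B‖ ^ 2 = 4 * (‖H‖ ^ 2 + ‖A‖ ^ 2 + ‖B‖ ^ 2) := by
  simp only [frobenius_norm_sq, ← Finset.sum_add_distrib, Finset.mul_sum]
  refine Finset.sum_congr rfl fun x _ => Finset.sum_congr rfl fun y _ => ?_
  simpa using norm_sq_add_phases (H x y) (A x y) (B x y)

lemma blockSlice_eq {n : Type*} (V : Fin 2 → Fin 2 → Matrix n n ℂ) (s t : ℝ) (z : ℂ)
    (hz : star z * z = 1) :
    blockSlice V ![(s : ℂ), t * z] = ((s : ℂ) ^ 2 • V 0 0 + (t : ℂ) ^ 2 • V 1 1)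
      + z • ((s * t : ℂ) • V 0 1) + star z • ((s * t : ℂ) • V 1 0) := by
  have h : star ((t : ℂ) * z) * (t * z) = (t : ℂ) ^ 2 := by
    rw [star_mul']
    calc _ = star (t : ℂ) * t * (star z * z) := by ring
      _ = _ := by rw [hz]; simp [sq]
  simp only [blockSlice, Fin.sum_univ_two, Matrix.cons_val_zero, Matrix.cons_val_one, h]
  simp only [Complex.star_def, map_mul, Complex.conj_ofReal, smul_smul]
  rw [show (s : ℂ) * s = s ^ 2 by ring, show (s : ℂ) * (t * z) = z * (s * t) by ring,
    show (t : ℂ) * (starRingEnd ℂ) z * s = (starRingEnd ℂ) z * (s * t) by ring]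
  abel

/-- The choice `s² = r`, `t² = p` balances the two summands on the right. If `p` or `r` vanishes,
one weight can grow freely while the right side stays fixed, which forces `q ≤ 0`. -/
lemma le_of_forall_mul_le_sq {p r q k : ℝ} (hp : 0 ≤ p) (hr : 0 ≤ r)
    (h : ∀ s t : ℝ, s ^ 2 * t ^ 2 * q ≤ k * (s ^ 2 * p + t ^ 2 * r) ^ 2) : q ≤ 4 * k * (p * r) := by
  have h' : ∀ u v : ℝ, 0 ≤ u → 0 ≤ v → u * v * q ≤ k * (u * p + v * r) ^ 2 := by
    intro u v hu hv
    simpa [Real.sq_sqrt hu, Real.sq_sqrt hv] using h (√u) (√v)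
  have key : ∀ c : ℝ, (∀ u : ℝ, 0 < u → u * q ≤ c) → q ≤ 0 := by
    intro c hc
    by_contra! hq
    have h1 := hc ((|c| + 1) / q) (by positivity)
    rw [div_mul_cancel₀ _ hq.ne'] at h1
    linarith [le_abs_self c]
  rcases hp.eq_or_lt with rfl | hp
  · have := key (k * r ^ 2) fun u hu => by simpa using h' u 1 hu.le zero_le_one
    simpa using this
  rcases hr.eq_or_lt with rfl | hr
  · have := key (k * p ^ 2) fun u hu => by simpa using h' 1 u zero_le_one hu.le
    simpa using this
  have h1 := h' r p hr.le hp.le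
  have h2 : 0 < r * p := by positivity
  refine le_of_mul_le_mul_left (h1.trans_eq ?_) h2
  ring

/-- With traceless off-diagonal blocks, the trace of a slice does not depend on the phase, so phase
averaging loses nothing on the right. For diagonal traces `p`, `r` the total is at most `C (p² + r²)
+ 4 (C - 1/N) p r = C (p - r)² + 4 (3/2 C - 1/N) p r`, to be compared with `D (p + r)² = D (p - r)²
+ 4 D p r`. -/
lemma sum_norm_sq_le_of_offDiag_trace_eq_zero {n : Type*} [Fintype n] [Nonempty n]
    (V : Fin 2 → Fin 2 → Matrix n n ℂ) {C D : ℝ} (hCD : C ≤ D)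
    (hCD' : 3 / 2 * C - (Fintype.card n : ℝ)⁻¹ ≤ D)
    (hpos : ∀ v, 0 ≤ trace (blockSlice V v))
    (hV : ∀ v, ‖blockSlice V v‖ ^ 2 ≤ C * ‖trace (blockSlice V v)‖ ^ 2)
    (h01 : trace (V 0 1) = 0) (h10 : trace (V 1 0) = 0) :
    ∑ i, ∑ j, ‖V i j‖ ^ 2 ≤ D * ‖trace (V 0 0) + trace (V 1 1)‖ ^ 2 := by
  have e0 : blockSlice V ![1, 0] = V 0 0 := by simp [blockSlice]
  have e1 : blockSlice V ![0, 1] = V 1 1 := by simp [blockSlice]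
  obtain ⟨p, hp, hp'⟩ : ∃ p : ℝ, 0 ≤ p ∧ trace (V 0 0) = p := by
    have := hpos ![1, 0]
    rw [e0] at this
    exact ⟨_, (Complex.nonneg_iff.1 this).1, Complex.eq_re_of_ofReal_le this⟩
  obtain ⟨r, hr, hr'⟩ : ∃ r : ℝ, 0 ≤ r ∧ trace (V 1 1) = r := by
    have := hpos ![0, 1]
    rw [e1] at this
    exact ⟨_, (Complex.nonneg_iff.1 this).1, Complex.eq_re_of_ofReal_le this⟩
  have b0 : ‖V 0 0‖ ^ 2 ≤ C * p ^ 2 := by simpa [e0, hp'] using hV ![1, 0]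
  have b1 : ‖V 1 1‖ ^ 2 ≤ C * r ^ 2 := by simpa [e1, hr'] using hV ![0, 1]
  set N : ℝ := (Fintype.card n : ℝ)
  have hN : 0 < N := by simp [N, Fintype.card_pos]
  have hq : ‖V 0 1‖ ^ 2 + ‖V 1 0‖ ^ 2 ≤ 4 * (C - N⁻¹) * (p * r) := by
    refine le_of_forall_mul_le_sq hp hr fun s t => ?_
    set H := (s : ℂ) ^ 2 • V 0 0 + (t : ℂ) ^ 2 • V 1 1 with hH
    have trH : trace H = ((s ^ 2 * p + t ^ 2 * r : ℝ) : ℂ) := by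
      simp [hH, hp', hr']
    have hb : ∀ z : ℂ, star z * z = 1 →
        ‖H + z • ((s * t : ℂ) • V 0 1) + star z • ((s * t : ℂ) • V 1 0)‖ ^ 2
          ≤ C * (s ^ 2 * p + t ^ 2 * r) ^ 2 := by
      intro z hz
      have h := hV ![(s : ℂ), t * z]
      rw [blockSlice_eq V s t z hz, ← hH] at h
      refine h.trans_eq ?_
      rw [trace_add, trace_add, trH]
      simp only [trace_smul, h01, h10, smul_zero, add_zero, Complex.norm_real, Real.norm_eq_abs,
        sq_abs]
    have h1 := hb 1 (by simp)
    have h2 := hb (-1) (by simp)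
    have h3 := hb Complex.I (by simp)
    have h4 := hb (-Complex.I) (by simp)
    have hsum := frobenius_norm_sq_add_phases H ((s * t : ℂ) • V 0 1) ((s * t : ℂ) • V 1 0)
    have hlow := norm_trace_sq_le H
    rw [trH, Complex.norm_real, Real.norm_eq_abs, sq_abs] at hlow
    simp only [Complex.star_def, map_neg, map_one, Complex.conj_I, one_smul, neg_smul, neg_neg,
      ← sub_eq_add_neg] at h1 h2 h3 h4
    have n1 : ‖(s * t : ℂ) • V 0 1‖ ^ 2 = s ^ 2 * t ^ 2 * ‖V 0 1‖ ^ 2 := by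
      rw [norm_smul]; simp [mul_pow]
    have n2 : ‖(s * t : ℂ) • V 1 0‖ ^ 2 = s ^ 2 * t ^ 2 * ‖V 1 0‖ ^ 2 := by
      rw [norm_smul]; simp [mul_pow]
    have hlow' : N⁻¹ * (s ^ 2 * p + t ^ 2 * r) ^ 2 ≤ ‖H‖ ^ 2 := by
      rwa [inv_mul_le_iff₀ hN]
    rw [n1, n2] at hsum
    linarith
  rw [hp', hr', ← Complex.ofReal_add, Complex.norm_real, Real.norm_eq_abs, sq_abs]
  simp only [Fin.sum_univ_two]
  have a1 : 0 ≤ (D - C) * (p - r) ^ 2 := mul_nonneg (sub_nonneg.2 hCD) (sq_nonneg _)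
  have a2 : 0 ≤ (D - (3 / 2 * C - N⁻¹)) * (p * r) :=
    mul_nonneg (sub_nonneg.2 hCD') (mul_nonneg hp hr)
  linarith

/-- A norm bound for all compressions of a `2 × 2` block matrix gives a bound for the matrix. -/
lemma sum_norm_sq_le {n : Type*} [Fintype n] [Nonempty n]
    (V : Fin 2 → Fin 2 → Matrix n n ℂ) {C D : ℝ} (hCD : C ≤ D)
    (hCD' : 3 / 2 * C - (Fintype.card n : ℝ)⁻¹ ≤ D)
    (hpos : ∀ v, 0 ≤ trace (blockSlice V v))
    (hV : ∀ v, ‖blockSlice V v‖ ^ 2 ≤ C * ‖trace (blockSlice V v)‖ ^ 2) :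
    ∑ i, ∑ j, ‖V i j‖ ^ 2 ≤ D * ‖trace (V 0 0) + trace (V 1 1)‖ ^ 2 := by
  -- A unitary change of basis in the outer factor that diagonalizes the matrix of block traces
  -- reduces to the traceless off-diagonal case; it permutes the slices and preserves the total norm
  -- and trace.
  set T : Matrix (Fin 2) (Fin 2) ℂ := Matrix.of fun i j => trace (V i j) with hT
  have hherm : T.IsHermitian := by
    have him : ∀ v : Fin 2 → ℂ, (trace (blockSlice V v)).im = 0 := fun v =>
      ((Complex.nonneg_iff.1 (hpos v)).2).symm
    -- Polarization: a quadratic form that is real on these four vectors is Hermitian.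
    have h0 := him ![1, 0]
    have h1 := him ![0, 1]
    have h2 := him ![1, 1]
    have h3 := him ![1, Complex.I]
    simp [blockSlice] at h0 h1 h2 h3
    refine IsHermitian.ext fun i j => ?_
    fin_cases i <;> fin_cases j <;> apply Complex.ext <;> simp [hT] <;> linarith
  set U : Matrix (Fin 2) (Fin 2) ℂ := (hherm.eigenvectorUnitary : Matrix (Fin 2) (Fin 2) ℂ)
  have hU : U * Uᴴ = 1 := Unitary.mul_star_self_of_mem hherm.eigenvectorUnitary.2
  have hdiag : Uᴴ * T * U = diagonal (RCLike.ofReal ∘ hherm.eigenvalues) := by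
    rw [← hherm.conjStarAlgAut_star_eigenvectorUnitary, Unitary.conjStarAlgAut_star_apply]
    rfl
  set V' : Fin 2 → Fin 2 → Matrix n n ℂ := fun i j =>
    ∑ k, ∑ l, (star (U k i) * U l j) • V k l with hV'
  have hslice : ∀ v, blockSlice V' v = blockSlice V (U *ᵥ v) := by
    intro v
    simp only [blockSlice, hV', Fin.sum_univ_two, mulVec, dotProduct, star_add, star_mul']
    module
  have htr : ∀ i j, trace (V' i j) = (Uᴴ * T * U) i j := by
    intro i j
    simp only [hV', hT, mul_apply, Fin.sum_univ_two, conjTranspose_apply, of_apply, trace_add,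
      trace_smul, smul_eq_mul]
    ring
  have hentry : ∀ i j x y, V' i j x y = (Uᴴ * Matrix.of (fun k l => V k l x y) * U) i j := by
    intro i j x y
    simp only [hV', mul_apply, Fin.sum_univ_two, conjTranspose_apply,
      of_apply, Matrix.add_apply, Matrix.smul_apply, smul_eq_mul]
    ring
  have hswap : ∀ F : Fin 2 → Fin 2 → Matrix n n ℂ, ∑ i, ∑ j, ‖F i j‖ ^ 2 =
      ∑ x, ∑ y, ‖(Matrix.of fun i j => F i j x y : Matrix (Fin 2) (Fin 2) ℂ)‖ ^ 2 := by
    intro F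
    simp only [frobenius_norm_sq, Fin.sum_univ_two, ← Finset.sum_add_distrib, of_apply]
  have hsum : ∑ i, ∑ j, ‖V' i j‖ ^ 2 = ∑ i, ∑ j, ‖V i j‖ ^ 2 := by
    rw [hswap, hswap]
    refine Finset.sum_congr rfl fun x _ => Finset.sum_congr rfl fun y _ => ?_
    rw [← frobenius_norm_unitary_conj U (Matrix.of fun i j => V i j x y) hU]
    congr 2
    ext i j
    exact hentry i j x y
  have htrace : trace (V' 0 0) + trace (V' 1 1) = trace (V 0 0) + trace (V 1 1) := by
    rw [htr, htr]
    calc _ = trace (Uᴴ * T * U) := by simp [trace, Fin.sum_univ_two]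
      _ = trace T := by rw [trace_mul_comm, ← Matrix.mul_assoc, hU, Matrix.one_mul]
      _ = _ := by simp [trace, Fin.sum_univ_two, hT]
  rw [← hsum, ← htrace]
  refine sum_norm_sq_le_of_offDiag_trace_eq_zero V' hCD hCD' (fun v => hslice v ▸ hpos _)
    (fun v => hslice v ▸ hV _) ?_ ?_
  · rw [htr, hdiag]; simp
  · rw [htr, hdiag]; simp

/-! ### Block-positive matrices and the induction on qubits -/

/-- A matrix is block-positive if it pairs nonnegatively with all products of positive
semidefinite matrices. -/
def IsBlockPositive {m : ℕ} (W : QubitMatrix m) : Prop :=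
  ∀ A : Fin m → Matrix (Fin 2) (Fin 2) ℂ, (∀ i, (A i).PosSemidef) → 0 ≤ trace (W * tensorProd A)

lemma tensorProd_one {ι : Type*} [Fintype ι] {n : ι → Type*} [∀ i, DecidableEq (n i)]
    [DecidableEq (∀ i, n i)] :
    tensorProd (fun i => (1 : Matrix (n i) (n i) ℂ)) = 1 := by
  ext x y
  simp only [tensorProd, of_apply, one_apply, funext_iff]
  by_cases h : ∀ i, x i = y i
  · simp [h]
  · rw [if_neg h]
    push Not at h
    obtain ⟨i, hi⟩ := h
    exact Finset.prod_eq_zero (Finset.mem_univ i) (if_neg hi)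

lemma IsBlockPositive.trace_nonneg {m : ℕ} {W : QubitMatrix m} (hW : IsBlockPositive W) :
    0 ≤ trace W := by
  have h := hW (fun _ => 1) fun _ => PosSemidef.one
  rwa [tensorProd_one, Matrix.mul_one] at h

/-- The blocks of a matrix on `m + 1` qubits with respect to the first qubit. -/
def qubitBlock {m : ℕ} (W : QubitMatrix (m + 1)) (i j : Fin 2) : QubitMatrix m :=
  Matrix.of fun x y => W (Fin.cons i x) (Fin.cons j y)

lemma sum_fin_cons {m : ℕ} {M : Type*} [AddCommMonoid M] (f : (Fin (m + 1) → Fin 2) → M) :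
    ∑ x, f x = ∑ i, ∑ x : Fin m → Fin 2, f (Fin.cons i x) := by
  rw [← Fintype.sum_prod_type', ← (Fin.consEquiv fun _ => Fin 2).sum_comp]
  rfl

lemma norm_sq_eq_sum_qubitBlock {m : ℕ} (W : QubitMatrix (m + 1)) :
    ‖W‖ ^ 2 = ∑ i, ∑ j, ‖qubitBlock W i j‖ ^ 2 := by
  simp only [frobenius_norm_sq, sum_fin_cons, qubitBlock, of_apply]
  exact Finset.sum_congr rfl fun i _ => Finset.sum_comm

lemma trace_eq_qubitBlock {m : ℕ} (W : QubitMatrix (m + 1)) :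
    trace W = trace (qubitBlock W 0 0) + trace (qubitBlock W 1 1) := by
  simp [trace, sum_fin_cons, qubitBlock, Fin.sum_univ_two]

lemma trace_mul_tensorProd_cons {m : ℕ} (W : QubitMatrix (m + 1)) (v : Fin 2 → ℂ)
    (A : Fin m → Matrix (Fin 2) (Fin 2) ℂ) :
    trace (W * tensorProd
        (Fin.cons (vecMulVec v (star v)) A : Fin (m + 1) → Matrix (Fin 2) (Fin 2) ℂ)) =
      trace (blockSlice (qubitBlock W) v * tensorProd A) := by
  simp only [blockSlice, Finset.sum_mul, smul_mul, trace_sum, trace_smul, smul_eq_mul]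
  simp only [trace, diag_apply, mul_apply, sum_fin_cons, tensorProd, of_apply, qubitBlock,
    Fin.prod_univ_succ, Fin.cons_zero, Fin.cons_succ, vecMulVec_apply, Finset.mul_sum,
    Pi.star_apply]
  refine Finset.sum_congr rfl fun i _ => ?_
  rw [Finset.sum_comm]
  refine Finset.sum_congr rfl fun j _ => Finset.sum_congr rfl fun x _ =>
    Finset.sum_congr rfl fun y _ => ?_
  ring

/-- Pairing a slice with a product is pairing `W` with the same product preceded by the rank-one
factor `v v†`. -/
lemma IsBlockPositive.blockSlice {m : ℕ} {W : QubitMatrix (m + 1)} (hW : IsBlockPositive W)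
    (v : Fin 2 → ℂ) : IsBlockPositive (blockSlice (qubitBlock W) v) := by
  intro A hA
  rw [← trace_mul_tensorProd_cons]
  refine hW _ fun i => ?_
  refine Fin.cases ?_ (fun i => ?_) i
  · exact posSemidef_vecMulVec_self_star v
  · exact hA i

lemma norm_sq_le_succ {m : ℕ} {C D : ℝ} (hCD : C ≤ D)
    (hCD' : 3 / 2 * C - ((2 : ℝ) ^ m)⁻¹ ≤ D)
    (h : ∀ W : QubitMatrix m, IsBlockPositive W → ‖W‖ ^ 2 ≤ C * ‖trace W‖ ^ 2)
    (W : QubitMatrix (m + 1)) (hW : IsBlockPositive W) : ‖W‖ ^ 2 ≤ D * ‖trace W‖ ^ 2 := by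
  rw [norm_sq_eq_sum_qubitBlock, trace_eq_qubitBlock]
  exact sum_norm_sq_le _ hCD (by simpa using hCD') (fun v => (hW.blockSlice v).trace_nonneg)
    fun v => h _ (hW.blockSlice v)

/-- The Frobenius norm of a block-positive matrix on `k + 2` qubits is at most `(3/2) ^ (k / 2)`
times its trace. -/
theorem IsBlockPositive.norm_sq_le (k : ℕ) (W : QubitMatrix (k + 2)) (hW : IsBlockPositive W) :
    ‖W‖ ^ 2 ≤ (3 / 2) ^ k * ‖trace W‖ ^ 2 := by
  induction k with
  | zero =>
    -- From one qubit to two, `3/2 - 1/2 = 1`; from none to one, `3/2 - 1 ≤ 1`. The `1/N` correction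
    -- thus keeps the constant at 1 up to two qubits, which is the source of the `-1` in the
    -- exponent `m/2 - 1`.
    refine norm_sq_le_succ (C := 1) (by norm_num) (by norm_num) ?_ W hW
    refine norm_sq_le_succ (C := 1) le_rfl (by norm_num) fun W _ => ?_
    simp [frobenius_norm_sq, trace]
  | succ k ih =>
    refine norm_sq_le_succ (C := (3 / 2) ^ k) ?_ ?_ ih W hW
    · rw [pow_succ]
      linarith [pow_pos (show (0 : ℝ) < 3 / 2 by norm_num) k]
    · rw [pow_succ]
      -- From here on the `1/N` correction is dropped.
      exact (sub_le_self _ (by positivity)).trans_eq (mul_comm _ _)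

/-! ### Trace pairing, tensor products and compactness -/

lemma norm_trace_mul_le {n : Type*} [Fintype n] (A B : Matrix n n ℂ) :
    ‖trace (A * B)‖ ≤ ‖A‖ * ‖B‖ := by
  refine abs_le_of_sq_le_sq' ?_ (by positivity) |>.2
  rw [mul_pow, ← frobenius_norm_transpose B, frobenius_norm_sq, frobenius_norm_sq,
    ← Fintype.sum_prod_type', ← Fintype.sum_prod_type']
  refine le_trans ?_ (Finset.sum_mul_sq_le_sq_mul_sq _ _ _)
  simp only [trace, diag_apply, mul_apply]
  rw [← Fintype.sum_prod_type']
  gcongr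
  refine (norm_sum_le _ _).trans_eq (Finset.sum_congr rfl fun x _ => ?_)
  simp

lemma trace_tensorProd {ι : Type*} [Fintype ι] [DecidableEq ι] {n : ι → Type*} [∀ i, Fintype (n i)]
    (A : ∀ i, Matrix (n i) (n i) ℂ) : trace (tensorProd A) = ∏ i, trace (A i) := by
  simp only [trace, tensorProd, diag_apply, of_apply]
  rw [Finset.prod_univ_sum, Fintype.piFinset_univ]

lemma tensorProd_smul {ι : Type*} [Fintype ι] {n : ι → Type*}
    (c : ι → ℝ) (A : ∀ i, Matrix (n i) (n i) ℂ) :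
    tensorProd (fun i => c i • A i) = (∏ i, c i) • tensorProd A := by
  ext x y
  simp [tensorProd, Finset.prod_mul_distrib]

lemma conjTranspose_tensorProd {ι : Type*} [Fintype ι] {n : ι → Type*}
    (A : ∀ i, Matrix (n i) (n i) ℂ) :
    (tensorProd A)ᴴ = tensorProd fun i => (A i)ᴴ := by
  ext x y
  simp [tensorProd]

-- Writing `A = B† B` gives `tr A = ‖B‖²`, while `‖B† B‖ ≤ ‖B‖²` by submultiplicativity.
open scoped MatrixOrder in
lemma norm_le_trace_re {n : Type*} [Fintype n] {A : Matrix n n ℂ} (hA : A.PosSemidef) :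
    ‖A‖ ≤ (trace A).re := by
  classical
  obtain ⟨B, rfl⟩ := CStarAlgebra.nonneg_iff_eq_star_mul_self.mp hA.nonneg
  rw [star_eq_conjTranspose, trace_conjTranspose_mul_self_eq, Complex.ofReal_re, sq]
  refine (frobenius_norm_mul _ _).trans_eq ?_
  rw [frobenius_norm_conjTranspose]

lemma isClosed_posSemidef {n : Type*} [Fintype n] :
    IsClosed {A : Matrix n n ℂ | A.PosSemidef} := by
  simp only [posSemidef_iff_dotProduct_mulVec, Set.ofPred_and, Set.ofPred_forall]
  refine IsClosed.inter ?_ (isClosed_iInter fun v => ?_)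
  · exact isClosed_eq (continuous_id.matrix_conjTranspose) continuous_id
  · exact isClosed_le continuous_const
      (continuous_const.dotProduct (continuous_id.matrix_mulVec continuous_const))

/-- The density matrices: positive semidefinite matrices of trace one. -/
def densityMatrices (n : Type*) [Fintype n] : Set (Matrix n n ℂ) :=
  {A | A.PosSemidef} ∩ {A | trace A = 1}

lemma isCompact_densityMatrices (n : Type*) [Fintype n] : IsCompact (densityMatrices n) := by
  refine Metric.isCompact_of_isClosed_isBounded ?_ ?_
  · exact isClosed_posSemidef.inter (isClosed_eq (continuous_id.matrix_trace) continuous_const)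
  · refine isBounded_iff_forall_norm_le.2 ⟨1, fun A hA => ?_⟩
    have h := norm_le_trace_re hA.1
    rwa [hA.2, Complex.one_re] at h

lemma continuous_tensorProd {ι : Type*} [Fintype ι] {n : ι → Type*} :
    Continuous (tensorProd : (∀ i, Matrix (n i) (n i) ℂ) → _) := by
  refine continuous_matrix fun x y => ?_
  simp only [tensorProd, of_apply]
  exact continuous_finsetProd _ fun i _ => (continuous_apply i).matrix_elem _ _

/-- In finite dimension the convex hull of a compact set is compact. -/
theorem isCompact_convexHull_of_finiteDimensional {E : Type*} [NormedAddCommGroup E]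
    [NormedSpace ℝ E] [FiniteDimensional ℝ E] {s : Set E} (hs : IsCompact s) :
    IsCompact (convexHull ℝ s) := by
  rcases s.eq_empty_or_nonempty with rfl | ⟨x₀, hx₀⟩
  · simp
  set d := Module.finrank ℝ E + 1
  have hK : IsCompact ((stdSimplex ℝ (Fin d)) ×ˢ (Set.univ.pi fun _ : Fin d => s)) :=
    (isCompact_stdSimplex ℝ (Fin d)).prod (isCompact_univ_pi fun _ => hs)
  have hcont : Continuous fun p : (Fin d → ℝ) × (Fin d → E) => ∑ i, p.1 i • p.2 i := by fun_prop
  convert hK.image hcont using 1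
  ext x
  constructor
  · intro hx
    -- Carathéodory: affine independence limits the number of points to dimension plus one, so the
    -- hull is a continuous image of the compact set simplex `× s^d`. Unused slots are padded with
    -- `x₀` at weight zero.
    obtain ⟨ι, _, z, w, hz, hind, hw, hw1, rfl⟩ := eq_pos_convex_span_of_mem_convexHull hx
    have hcard : Fintype.card ι ≤ Fintype.card (Fin d) := by
      rw [Fintype.card_fin]
      exact hind.card_le_finrank_succ.trans (Nat.succ_le_succ (Submodule.finrank_le _))
    obtain ⟨e⟩ := Function.Embedding.nonempty_of_card_le hcard
    have hinj := e.injective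
    have h0 : ∀ j ∉ Set.range e, Function.extend e w 0 j = 0 := fun j hj =>
      Function.extend_apply' _ _ _ fun ⟨i, hi⟩ => hj ⟨i, hi⟩
    refine ⟨(Function.extend e w 0, Function.extend e z fun _ => x₀), ⟨⟨fun j => ?_, ?_⟩, ?_⟩, ?_⟩
    · show 0 ≤ Function.extend e w 0 j
      by_cases hj : j ∈ Set.range e
      · obtain ⟨i, rfl⟩ := hj
        rw [hinj.extend_apply]
        exact (hw i).le
      · rw [h0 j hj]
    · rw [← hw1]
      refine (Fintype.sum_of_injective e hinj _ _ h0 fun i => ?_).symm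
      rw [hinj.extend_apply]
    · intro j _
      by_cases hj : j ∈ Set.range e
      · obtain ⟨i, rfl⟩ := hj
        simp only [hinj.extend_apply]
        exact hz ⟨i, rfl⟩
      · simp only
        rw [Function.extend_apply' _ _ _ fun ⟨i, hi⟩ => hj ⟨i, hi⟩]
        exact hx₀
    · refine (Fintype.sum_of_injective e hinj _ _ (fun j hj => ?_) fun i => ?_).symm
      · simp only [h0 j hj, zero_smul]
      · simp only [hinj.extend_apply]
  · rintro ⟨⟨w, z⟩, ⟨hw, hz⟩, rfl⟩
    exact (convex_convexHull ℝ s).sum_mem (fun i _ => hw.1 i) hw.2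
      fun i _ => subset_convexHull ℝ s (hz i trivial)

/-! ### Separation of non-separable matrices by witnesses -/

lemma exists_eq_trace_mul {n : Type*} [Fintype n] (F : Matrix n n ℂ →ₗ[ℂ] ℂ) :
    ∃ W : Matrix n n ℂ, ∀ X, F X = trace (W * X) := by
  classical
  refine ⟨Matrix.of fun y x => F (single x y 1), fun X => ?_⟩
  conv_lhs => rw [matrix_eq_sum_single X]
  simp only [map_sum, trace, diag_apply, mul_apply, of_apply]
  rw [Finset.sum_comm]
  refine Finset.sum_congr rfl fun y _ => Finset.sum_congr rfl fun x _ => ?_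
  rw [show single x y (X x y) = X x y • single x y (1 : ℂ) by simp [smul_single], map_smul,
    smul_eq_mul, mul_comm]

lemma exists_eq_smul_density {n : Type*} [Fintype n] {A : Matrix n n ℂ} (hA : A.PosSemidef) :
    A = 0 ∨ 0 < (trace A).re ∧ ∃ B ∈ densityMatrices n, A = (trace A).re • B := by
  have hnorm := norm_le_trace_re hA
  rcases eq_or_ne A 0 with h | h
  · exact Or.inl h
  have hpos : 0 < (trace A).re := (norm_pos_iff.2 h).trans_le hnorm
  refine Or.inr ⟨hpos, (trace A).re⁻¹ • A, ⟨hA.smul (inv_nonneg.2 hpos.le), ?_⟩, ?_⟩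
  · have h1 : trace A = ((trace A).re : ℂ) :=
      Complex.eq_re_of_ofReal_le (r := 0) (by simpa using hA.trace_nonneg)
    rw [Set.mem_ofPred_eq, trace_smul]
    rw [Complex.real_smul, Complex.ofReal_inv]
    conv_lhs => rw [h1]
    simp only [Complex.ofReal_re]
    exact inv_mul_cancel₀ (by exact_mod_cast hpos.ne')
  · rw [smul_inv_smul₀ hpos.ne']

/-- A nonzero positive semidefinite matrix outside the separable cone is detected by a
block-positive matrix. -/
theorem exists_isBlockPositive_trace_mul_neg {m : ℕ} {ρ : QubitMatrix m} (hρ : ρ.PosSemidef)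
    (hsep : ¬ IsSeparable ρ) :
    ∃ W : QubitMatrix m, IsBlockPositive W ∧ (trace (W * ρ)).re < 0 := by
  -- Separation is applied to the trace-one product states, whose hull is compact; this avoids
  -- proving that the separable cone is closed.
  set K : Set (QubitMatrix m) :=
    convexHull ℝ (tensorProd '' Set.univ.pi fun _ => densityMatrices (Fin 2)) with hK
  have hKc : IsCompact K := isCompact_convexHull_of_finiteDimensional
    ((isCompact_univ_pi fun _ => isCompact_densityMatrices (Fin 2)).image continuous_tensorProd)
  have hKsep : K ⊆ {X | IsSeparable X} := by
    refine convexHull_min ?_ ?_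
    · rintro _ ⟨A, hA, rfl⟩
      exact PointedCone.subset_hull ⟨A, fun i => (hA i trivial).1, rfl⟩
    · exact (separableCone fun _ : Fin m => psdCone (Fin 2)).convex
  rcases exists_eq_smul_density hρ with rfl | ⟨hpos, σ, hσ, hρσ⟩
  · exact absurd (Submodule.zero_mem _) hsep
  have hσK : σ ∉ K := by
    intro h
    refine hsep ?_
    rw [hρσ]
    exact PointedCone.smul_mem _ hpos.le (hKsep h)
  have : LocallyConvexSpace ℝ (QubitMatrix m) := NormedSpace.toLocallyConvexSpace
  obtain ⟨f, u, hfσ, hfK⟩ :=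
    RCLike.geometric_hahn_banach_point_closed (𝕜 := ℂ) (convex_convexHull ℝ _) hKc.isClosed hσK
  -- On trace-one matrices, subtracting `u · tr` moves the separating threshold to zero, and the
  -- resulting signs extend to positive multiples.
  obtain ⟨W, hW⟩ := exists_eq_trace_mul (f.toLinearMap - (u : ℂ) • traceLinearMap _ ℂ ℂ)
  simp only [LinearMap.sub_apply, LinearMap.smul_apply, traceLinearMap_apply, smul_eq_mul] at hW
  have hherm : ∀ X : QubitMatrix m, X.IsHermitian →
      trace (((1 / 2 : ℝ) • (W + Wᴴ)) * X) = ((trace (W * X)).re : ℂ) := by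
    intro X hX
    have h : trace (Wᴴ * X) = star (trace (W * X)) := by
      rw [← trace_conjTranspose, conjTranspose_mul, hX.eq, trace_mul_comm]
    rw [smul_mul, trace_smul, Matrix.add_mul, trace_add, h, Complex.star_def, Complex.add_conj,
      Complex.real_smul]
    push_cast
    ring
  -- Separation controls only real parts, whereas block-positivity in `ℂ` also requires real
  -- pairings; hence the Hermitian part.
  refine ⟨(1 / 2 : ℝ) • (W + Wᴴ), fun A hA => ?_, ?_⟩
  · have hAh : (tensorProd A).IsHermitian := by
      rw [IsHermitian, conjTranspose_tensorProd]
      exact congrArg _ (funext fun i => (hA i).1)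
    rw [hherm _ hAh, Complex.zero_le_real]
    by_cases h0 : ∃ i, A i = 0
    · obtain ⟨i, hi⟩ := h0
      have : tensorProd A = 0 := by
        ext x y
        exact Finset.prod_eq_zero (Finset.mem_univ i) (by simp [hi])
      simp [this]
    · push Not at h0
      have hB : ∀ i, 0 < (trace (A i)).re ∧
          ∃ B ∈ densityMatrices (Fin 2), A i = (trace (A i)).re • B :=
        fun i => (exists_eq_smul_density (hA i)).resolve_left (h0 i)
      choose hc B hBd hAB using hB
      rw [show A = fun i => (trace (A i)).re • B i from funext hAB, tensorProd_smul, Matrix.mul_smul,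
        trace_smul, Complex.smul_re, smul_eq_mul]
      refine mul_nonneg (Finset.prod_nonneg fun i _ => (hc i).le) ?_
      rw [← hW, trace_tensorProd, Finset.prod_eq_one fun i _ => (hBd i).2]
      have := hfK _ (subset_convexHull ℝ _ ⟨B, fun i _ => hBd i, rfl⟩)
      simpa using this.le
  · rw [hherm _ hρ.1, Complex.ofReal_re, hρσ, Matrix.mul_smul, trace_smul, Complex.smul_re, smul_eq_mul]
    refine mul_neg_of_pos_of_neg hpos ?_
    rw [← hW, hσ.2]
    simpa using hfσ

/-! ### Small cases and the separable ball -/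

lemma isSeparable_zero_qubits {ρ : QubitMatrix 0} (hρ : ρ.PosSemidef) :
    IsSeparable ρ := by
  have h1 : ρ = (trace ρ).re • tensorProd fun _ => (1 : Matrix (Fin 2) (Fin 2) ℂ) := by
    rw [tensorProd_one]
    ext x y
    obtain rfl := Subsingleton.elim x y
    have h2 : trace ρ = ρ x x := by
      rw [trace, Fintype.sum_subsingleton _ x, diag_apply]
    have h1 : trace ρ = ((trace ρ).re : ℂ) :=
      Complex.eq_re_of_ofReal_le (r := 0) (by simpa using hρ.trace_nonneg)
    rw [← h2]
    simpa using h1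
  rw [h1]
  exact PointedCone.smul_mem _ (Complex.nonneg_iff.1 hρ.trace_nonneg).1
    (PointedCone.subset_hull ⟨_, fun _ => PosSemidef.one, rfl⟩)

lemma isSeparable_one_qubit {ρ : QubitMatrix 1} (hρ : ρ.PosSemidef) : IsSeparable ρ := by
  refine PointedCone.subset_hull
    ⟨fun _ => ρ.submatrix (fun a _ => a) (fun a _ => a), fun _ => hρ.submatrix _, ?_⟩
  ext x y
  simp only [tensorProd, of_apply, Finset.univ_unique, Finset.prod_singleton, submatrix_apply]
  congr 1 <;> exact funext fun i => by rw [Subsingleton.elim i default]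

/-- The Frobenius ball of squared radius `(2/3) ^ k` around the identity on `k + 2` qubits contains
only separable positive semidefinite matrices. -/
theorem isSeparable_of_norm_sub_one_sq_le {k : ℕ} {ρ : QubitMatrix (k + 2)} (hρ : ρ.PosSemidef)
    (h : ‖ρ - 1‖ ^ 2 ≤ (2 / 3) ^ k) : IsSeparable ρ := by
  by_contra hsep
  obtain ⟨W, hW, hneg⟩ := exists_isBlockPositive_trace_mul_neg hρ hsep
  have hWn := hW.norm_sq_le k
  have ht := Complex.nonneg_iff.1 hW.trace_nonneg
  have htn : ‖trace W‖ = (trace W).re := by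
    rw [← Complex.re_eq_norm.2 hW.trace_nonneg]
  have hprod : ‖W‖ * ‖ρ - 1‖ ≤ (trace W).re := by
    -- The growth factor `(3/2)^k` of the witness bound cancels exactly against the squared radius
    -- `(2/3)^k`.
    refine abs_le_of_sq_le_sq' ?_ ht.1 |>.2
    rw [← htn]
    calc (‖W‖ * ‖ρ - 1‖) ^ 2 = ‖W‖ ^ 2 * ‖ρ - 1‖ ^ 2 := by ring
      _ ≤ ((3 / 2) ^ k * ‖trace W‖ ^ 2) * (2 / 3) ^ k := by gcongr
      _ = ((3 / 2) * (2 / 3)) ^ k * ‖trace W‖ ^ 2 := by rw [mul_pow]; ring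
      _ = ‖trace W‖ ^ 2 := by norm_num
  have hsplit : trace (W * ρ) = trace W + trace (W * (ρ - 1)) := by
    rw [Matrix.mul_sub, trace_sub, Matrix.mul_one]
    ring
  rw [hsplit, Complex.add_re] at hneg
  have h1 := (norm_trace_mul_le W (ρ - 1)).trans hprod
  have h2 := (abs_le.1 (Complex.abs_re_le_norm (trace (W * (ρ - 1))))).1
  linarith

end MultipartiteSeparability

theorem mainTheorem3 (m : ℕ) :
    (∀ ρ : MultipartiteSeparability.QubitMatrix m, ρ.PosSemidef →
      ‖ρ - 1‖ ≤ (2 / 3 : ℝ) ^ ((m : ℝ) / 2 - 1) →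
        MultipartiteSeparability.IsSeparable ρ) ∧
    (2 < m → (1 / 2 : ℝ) ^ ((m : ℝ) / 2 - 1) < (2 / 3 : ℝ) ^ ((m : ℝ) / 2 - 1)) := by
  refine ⟨fun ρ hρ h => ?_, fun hm => ?_⟩
  -- With at most one qubit, positive semidefiniteness alone gives separability; the norm argument
  -- starts at two qubits.
  · match m, ρ, hρ, h with
    | 0, ρ, hρ, _ => exact MultipartiteSeparability.isSeparable_zero_qubits hρ
    | 1, ρ, hρ, _ => exact MultipartiteSeparability.isSeparable_one_qubit hρ
    | k + 2, ρ, hρ, h =>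
      refine MultipartiteSeparability.isSeparable_of_norm_sub_one_sq_le hρ ?_
      calc ‖ρ - 1‖ ^ 2 ≤ ((2 / 3 : ℝ) ^ (((k + 2 : ℕ) : ℝ) / 2 - 1)) ^ 2 := by gcongr
        _ = (2 / 3) ^ k := by
          rw [← Real.rpow_natCast, ← Real.rpow_mul (by norm_num), ← Real.rpow_natCast]
          congr 1
          push_cast
          ring
  · have : (2 : ℝ) < m := by exact_mod_cast hm
    exact Real.rpow_lt_rpow (by norm_num) (by norm_num) (by linarith)
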